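/- **Conventions.** Let $\mathbf{T}^2=\mathbb{R}^2/\mathbb{Z}^2$. An oriented line in $\mathbf{T}^2$ is a closed geodesic with a primitive tangent vector $\gamma\in\mathbb{Z}^2$; its homology class in $H_1(\mathbf{T}^2)=\mathbb{Z}^2$ is $\gamma$. An oriented line arrangement $\mathcal{H}$ is a finite set of oriented lines. It is *simple* if no three distinct lines of $\mathcal{H}$ have a common point. Let $\mathcal{N}$ be a convex lattice polygon whose edges, taken counterclockwise, are the vectors $\Gamma_1,\dots,\Gamma_m$, and let $M$ be clockwise rotation by $\pi/2$. Then $\mathcal{H}$ is *dual* to $\mathcal{N}$ if the classes $\mathcal{H}_k$ of parallel and equally oriented lines of $\mathcal{H}$ are in bijection with the edges $\Gamma_k$, in such a way that the total homology class of $\mathcal{H}_k$ is $M\Gamma_k$. The cells are the connected components of $\mathbf{T}^2\setminus\mathcal{H}$; a cell is *oriented* if its boundary edges are consistently oriented, and $\mathcal{H}$ is *admissible* if every edge of the arrangement bounds an oriented cell. An *index map* of $\mathcal{H}$ assigns an integer $\iota(P)$ to every cell $P$ so that, on crossing a line with tangent vector $\gamma$ in a direction $\ell$, the index increases by one if $(\ell,\gamma)$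 is a positively oriented basis and decreases by one if it is negatively oriented. The *index graph* of $(\mathcal{H},\iota)$, for $\mathcal{H}$ simple, has a white vertex for each cell with $\iota\equiv 1 \pmod 4$, a black vertex for each cell with $\iota\equiv-1\pmod 4$, and one edge for each crossing point at which two opposite cells $P_1,P_2$ have odd indices; this edge joins the two cells, and it is directed if $\iota(P_1)\equiv\iota(P_2)\pmod 4$ and undirected otherwise. It is called bipartite if it has no directed edges and each of its edges joins a white vertex to a black one. A dimer model is in particular a bipartite graph. **Statement.** Let $k\ge 5$ be an integer and let $\mathcal{N}$ be the polygon with vertices $(0,0)$, $(1,0)$, $(0,1)$, $(k+1,1)$, $(1,2)$. 1. No simple oriented line arrangement in $\mathbf{T}^2$ that is dual to $\mathcal{N}$ is admissible. 2. Hence the Hanany--Vegh algorithm for $\mathcal{N}$ cannot produce a dimer model. (This algorithm takes as input an admissible simple arrangement dual to $\mathcal{N}$ and returns the bipartite graph whose white and black vertices are the clockwise and the counterclockwise oriented cells, with one edge for each crossing point at which two such cells are opposite.) 3. Likewise, Stienstra's algorithm for $\mathcal{N}$ cannot produce a dimer model. (This algorithm searches among the simple line arrangements dual to $\mathcal{N}$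 for one whose index graph is a dimer model.) In fact, for every simple arrangement dual to $\mathcal{N}$ and every index map of it, the index graph is not bipartite. -/

import Mathlib

namespace ToricDimer

/-! ### The torus and its oriented lines -/

/-- The real two-torus `ℝ² / ℤ²`. -/
abbrev Torus : Type := UnitAddCircle × UnitAddCircle

/-- The point `θ + t v` of the torus, for an integer vector `v`. -/
def move (θ : Torus) (v : ℤ × ℤ) (t : ℝ) : Torus :=
  (θ.1 + ((t * (v.1 : ℝ) : ℝ) : UnitAddCircle), θ.2 + ((t * (v.2 : ℝ) : ℝ) : UnitAddCircle))

/-- The determinant of a pair of integer vectors; it is positive exactly if the pair is a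
positively oriented basis. -/
def det (v w : ℤ × ℤ) : ℤ := v.1 * w.2 - v.2 * w.1

/-- The automorphism `M` of `ℤ²` given by clockwise rotation by `π / 2`. -/
def rotM : (ℤ × ℤ) ≃+ (ℤ × ℤ) where
  toFun v := (v.2, -v.1)
  invFun v := (-v.2, v.1)
  left_inv v := by simp
  right_inv v := by simp
  map_add' v w := by ext <;> simp [add_comm]

/-- An oriented line (hyperplane) in the torus: a closed geodesic with primitive integer tangent
vector `dir`. A line with tangent vector `d` is the level set of `θ ↦ d₁ θ₂ - d₂ θ₁` at a unique
value, which is recorded as `offset`; see `OrientedLine.carrier_eq_range`. -/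
structure OrientedLine where
  dir : ℤ × ℤ
  primitive : IsCoprime dir.1 dir.2
  offset : UnitAddCircle

/-- The underlying point set of an oriented line. -/
def OrientedLine.carrier (l : OrientedLine) : Set Torus :=
  {θ | l.dir.1 • θ.2 - l.dir.2 • θ.1 = l.offset}

theorem OrientedLine.carrier_nonempty (l : OrientedLine) : l.carrier.Nonempty := by
  obtain ⟨a, b, h⟩ := l.primitive
  refine ⟨(-(b • l.offset), a • l.offset), ?_⟩
  have : l.dir.1 • (a • l.offset) - l.dir.2 • (-(b • l.offset))
      = (a * l.dir.1 + b * l.dir.2) • l.offset := by module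
  simp only [OrientedLine.carrier, Set.mem_ofPred_eq]
  rw [this, h, one_smul]

/-- The carrier of a line is the image of the parametrized line `t ↦ θ + t d` through any of its
points `θ`. -/
theorem OrientedLine.carrier_eq_range (l : OrientedLine) {θ : Torus} (hθ : θ ∈ l.carrier) :
    l.carrier = Set.range (move θ l.dir) := by
  obtain ⟨a, b, h⟩ := l.primitive
  have hR : (a : ℝ) * l.dir.1 + b * l.dir.2 = 1 := by exact_mod_cast h
  obtain ⟨x, y⟩ := θ
  simp only [OrientedLine.carrier, Set.mem_ofPred_eq] at hθ
  ext ⟨u, v⟩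
  simp only [OrientedLine.carrier, Set.mem_ofPred_eq, Set.mem_range, move, Prod.mk.injEq]
  constructor
  · intro huv
    obtain ⟨p, hp⟩ := QuotientAddGroup.mk_surjective (u - x)
    obtain ⟨q, hq⟩ := QuotientAddGroup.mk_surjective (v - y)
    have hp' : ((p : ℝ) : UnitAddCircle) = u - x := hp
    have hq' : ((q : ℝ) : UnitAddCircle) = v - y := hq
    have h0 : ((l.dir.1 * q - l.dir.2 * p : ℝ) : UnitAddCircle) = 0 := by
      have e : ((l.dir.1 * q - l.dir.2 * p : ℝ) : UnitAddCircle)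
          = l.dir.1 • ((q : ℝ) : UnitAddCircle) - l.dir.2 • ((p : ℝ) : UnitAddCircle) := by
        rw [← AddCircle.coe_zsmul, ← AddCircle.coe_zsmul, ← AddCircle.coe_sub, zsmul_eq_mul,
          zsmul_eq_mul]
      rw [e, hp', hq', smul_sub, smul_sub]
      rw [← hθ] at huv
      rw [sub_sub_sub_comm, huv, sub_self]
    obtain ⟨n, hn⟩ := (AddCircle.coe_eq_zero_iff (1 : ℝ)).1 h0
    have hn' : (n : ℝ) = l.dir.1 * q - l.dir.2 * p := by simpa using hn
    have int0 : ∀ m : ℤ, (((m : ℝ)) : UnitAddCircle) = 0 := fun m =>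
      (AddCircle.coe_eq_zero_iff (1 : ℝ)).2 ⟨m, by simp⟩
    refine ⟨a * p + b * q, ?_, ?_⟩
    · have e : (a * p + b * q) * (l.dir.1 : ℝ) = p + ((n * b : ℤ) : ℝ) := by
        push_cast
        linear_combination p * hR - b * hn'
      rw [e, AddCircle.coe_add, int0, hp']
      abel
    · have e : (a * p + b * q) * (l.dir.2 : ℝ) = q + ((-(n * a) : ℤ) : ℝ) := by
        push_cast
        linear_combination q * hR + a * hn'
      rw [e, AddCircle.coe_add, int0, hq']
      abel
  · rintro ⟨t, rfl, rfl⟩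
    rw [← hθ, smul_add, smul_add, ← AddCircle.coe_zsmul, ← AddCircle.coe_zsmul, zsmul_eq_mul,
      zsmul_eq_mul]
    have : (l.dir.1 : ℝ) * (t * l.dir.2) = l.dir.2 * (t * l.dir.1) := by ring
    rw [this]
    abel

/-! ### Lattice polygons and their dual arrangements -/

/-- A convex lattice polygon, given by its vertices in counterclockwise cyclic order: every vertex
that is not an endpoint of the edge from `vertex i` to `vertex (i + 1)` lies strictly to the left
of that edge. -/
structure LatticePolygon where
  numVertices : ℕ
  three_le : 3 ≤ numVertices
  vertex : ZMod numVertices → ℤ × ℤ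
  convex : ∀ i j, j ≠ i → j ≠ i + 1 →
    0 < det (vertex (i + 1) - vertex i) (vertex j - vertex i)

/-- The facet `Γ` with endpoints `vertex i` and `vertex (i + 1)`, identified with the vector
`vertex (i + 1) - vertex i`. -/
def LatticePolygon.facet (N : LatticePolygon) (i : ZMod N.numVertices) : ℤ × ℤ :=
  N.vertex (i + 1) - N.vertex i

/-- An oriented line arrangement in the torus. -/
abbrev Arrangement : Type := Finset OrientedLine

/-- The map `M⁻¹ ∘ h`, where `h` is the homology class in `H₁(𝐓²) = ℤ²`. The class of a single
closed geodesic with primitive tangent vector `d` is `d`. -/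
def hHat (S : Arrangement) : ℤ × ℤ := rotM.symm (∑ l ∈ S, l.dir)

/-- The arrangement is dual to the polygon `N`: its classes of parallel, equally oriented lines are
in bijection with the facets of `N`, in such a way that `hHat` of a class is the corresponding
facet. (A class is named by the common tangent vector of its lines.) -/
def IsDual (H : Arrangement) (N : LatticePolygon) : Prop :=
  ∃ e : {d // d ∈ H.image OrientedLine.dir} ≃ ZMod N.numVertices,
    ∀ d, hHat (H.filter (fun l => l.dir = d.1)) = N.facet (e d)

/-- An arrangement is simple (generic) if no three distinct lines have a common point. -/
def IsSimple (H : Arrangement) : Prop :=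
  ∀ l₁ ∈ H, ∀ l₂ ∈ H, ∀ l₃ ∈ H, l₁ ≠ l₂ → l₁ ≠ l₃ → l₂ ≠ l₃ →
    l₁.carrier ∩ l₂.carrier ∩ l₃.carrier = ∅

/-! ### Cells, edges, and admissibility -/

/-- The union of the lines of the arrangement. -/
def support (H : Arrangement) : Set Torus := ⋃ l ∈ H, l.carrier

/-- The cells (regions) are the connected components of the complement of the arrangement. -/
def IsCell (H : Arrangement) (P : Set Torus) : Prop :=
  ∃ θ ∈ (support H)ᶜ, P = connectedComponentIn (support H)ᶜ θ

/-- The points of the line `l` that lie on no other line of the arrangement. -/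
def smoothPart (H : Arrangement) (l : OrientedLine) : Set Torus :=
  l.carrier \ ⋃ l' ∈ {l' : OrientedLine | l' ∈ H ∧ l' ≠ l}, l'.carrier

/-- The (open) edges of the cell complex that lie on the line `l`. -/
def IsEdge (H : Arrangement) (l : OrientedLine) (e : Set Torus) : Prop :=
  ∃ θ ∈ smoothPart H l, e = connectedComponentIn (smoothPart H l) θ

/-- From the point `θ`, the set `P` is entered at once in the direction `v`. -/
def LiesInDirection (P : Set Torus) (θ : Torus) (v : ℤ × ℤ) : Prop :=
  ∀ᶠ t in nhdsWithin (0 : ℝ) (Set.Ioi 0), move θ v t ∈ P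

/-- `P` lies on the left-hand side of the oriented line `l` near `θ`. -/
def LiesLeft (P : Set Torus) (l : OrientedLine) (θ : Torus) : Prop :=
  LiesInDirection P θ (rotM.symm l.dir)

/-- `P` lies on the right-hand side of the oriented line `l` near `θ`. -/
def LiesRight (P : Set Torus) (l : OrientedLine) (θ : Torus) : Prop :=
  LiesInDirection P θ (rotM l.dir)

/-- The cell `P` lies nowhere to the right of an edge: the edges in its boundary run
counterclockwise around `P`. -/
def IsCounterclockwise (H : Arrangement) (P : Set Torus) : Prop :=
  IsCell H P ∧ ∀ l ∈ H, ∀ θ ∈ smoothPart H l, ¬ LiesRight P l θ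

/-- The cell `P` lies nowhere to the left of an edge: the edges in its boundary run
clockwise around `P`. -/
def IsClockwise (H : Arrangement) (P : Set Torus) : Prop :=
  IsCell H P ∧ ∀ l ∈ H, ∀ θ ∈ smoothPart H l, ¬ LiesLeft P l θ

/-- A cell is oriented if its boundary is consistently oriented. -/
def IsOriented (H : Arrangement) (P : Set Torus) : Prop :=
  IsCounterclockwise H P ∨ IsClockwise H P

/-- The arrangement is admissible if each edge bounds an oriented region. -/
def IsAdmissible (H : Arrangement) : Prop :=
  ∀ l ∈ H, ∀ e, IsEdge H l e → ∃ P, IsOriented H P ∧ e ⊆ frontier P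

/-! ### The graphs constructed from an arrangement -/

/-- A mixed bicolored graph with vertices in `V`; its edges carry a label in `E`, so that multiple
edges are possible. -/
structure MixedGraph (V E : Type*) where
  white : Set V
  black : Set V
  undirected : Set (E × Sym2 V)
  directed : Set (E × V × V)

/-- The graph is bipartite with color classes `white` and `black`, and it has no directed edges.
Every dimer model has this property. -/
def MixedGraph.IsBipartite {V E : Type*} (G : MixedGraph V E) : Prop :=
  G.directed = ∅ ∧ Disjoint G.white G.black ∧
    ∀ e ∈ G.undirected, ∃ w ∈ G.white, ∃ b ∈ G.black, e.2 = s(w, b)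

/-- The cells `P` and `Q` are opposite at the crossing `p` of two lines, and at `p` the edges of `P`
are oriented towards `p` and the edges of `Q` are oriented outwards from `p`. -/
def OppositeInOut (H : Arrangement) (p : Torus) (P Q : Set Torus) : Prop :=
  IsCell H P ∧ IsCell H Q ∧ ∃ l ∈ H, ∃ l' ∈ H, det l.dir l'.dir ≠ 0 ∧
    p ∈ l.carrier ∧ p ∈ l'.carrier ∧
    LiesInDirection P p (-(l.dir + l'.dir)) ∧ LiesInDirection Q p (l.dir + l'.dir)

/-- The cells `P` and `Q` are opposite at the crossing `p` of two lines, and at `p` the boundary of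
each of them consists of one incoming and one outgoing edge. -/
def OppositeOriented (H : Arrangement) (p : Torus) (P Q : Set Torus) : Prop :=
  IsCell H P ∧ IsCell H Q ∧ ∃ l ∈ H, ∃ l' ∈ H, det l.dir l'.dir ≠ 0 ∧
    p ∈ l.carrier ∧ p ∈ l'.carrier ∧
    LiesInDirection P p (l.dir - l'.dir) ∧ LiesInDirection Q p (l'.dir - l.dir)

/-- An index map of the arrangement: an integer for every cell, subject to the crossing rule. When a
line with tangent vector `γ` is crossed from its left to its right, in the direction `rotM γ`,
the pair `(rotM γ, γ)` is positively oriented, so the index increases by one. Only the values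
at cells matter. -/
def IsIndexMap (H : Arrangement) (ι : Set Torus → ℤ) : Prop :=
  ∀ l ∈ H, ∀ θ ∈ smoothPart H l, ∀ P Q, IsCell H P → IsCell H Q →
    LiesLeft P l θ → LiesRight Q l θ → ι Q = ι P + 1

/-- The index graph of an arrangement with an index map. Its vertices are the cells of odd index,
white if the index is `1` modulo `4` and black if it is `-1` modulo `4`; each crossing at which the
cells of one of the two opposite pairs have odd indices gives an edge, which is directed if the two
indices agree modulo `4` and undirected otherwise. Shifting the index map by one gives the even
index graph. -/
def indexGraph (H : Arrangement) (ι : Set Torus → ℤ) : MixedGraph (Set Torus) Torus where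
  white := {P | IsCell H P ∧ ι P ≡ 1 [ZMOD 4]}
  black := {P | IsCell H P ∧ ι P ≡ -1 [ZMOD 4]}
  undirected := {e | ∃ P Q, e.2 = s(P, Q) ∧ (OppositeInOut H e.1 P Q ∨ OppositeOriented H e.1 P Q) ∧
    Odd (ι P) ∧ Odd (ι Q) ∧ ¬ ι P ≡ ι Q [ZMOD 4]}
  directed := {e | OppositeInOut H e.1 e.2.1 e.2.2 ∧
    Odd (ι e.2.1) ∧ Odd (ι e.2.2) ∧ ι e.2.1 ≡ ι e.2.2 [ZMOD 4]}

/-- The graph with one white vertex for each clockwise oriented cell, one black vertex for each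
counterclockwise oriented cell, and one edge for each crossing at which two such cells are
opposite. -/
def orientedCellGraph (H : Arrangement) : MixedGraph (Set Torus) Torus where
  white := {P | IsClockwise H P}
  black := {P | IsCounterclockwise H P}
  undirected := {e | ∃ P Q, e.2 = s(P, Q) ∧ OppositeOriented H e.1 P Q ∧
    IsClockwise H P ∧ IsCounterclockwise H Q}
  directed := ∅

/-- `G` is an output of the Hanany--Vegh algorithm for the polygon `N`. The algorithm takes an
admissible simple dual line arrangement of `N` and returns its graph of oriented cells. -/
def HananyVeghOutput (N : LatticePolygon) (G : MixedGraph (Set Torus) Torus) : Prop :=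
  ∃ H : Arrangement, IsDual H N ∧ IsSimple H ∧ IsAdmissible H ∧ G = orientedCellGraph H

/-- `G` is a graph that is met in the course of Stienstra's algorithm for the polygon `N`: the
algorithm starts from an arbitrary simple dual line arrangement of `N` and searches among such
arrangements for one whose index graph is a dimer model. -/
def StienstraGraph (N : LatticePolygon) (G : MixedGraph (Set Torus) Torus) : Prop :=
  ∃ (H : Arrangement) (ι : Set Torus → ℤ),
    IsDual H N ∧ IsSimple H ∧ IsIndexMap H ι ∧ G = indexGraph H ι

/-! ### The pentagon -/

/-- The pentagon with vertices `(0,0)`, `(1,0)`, `(k+1,1)`, `(1,2)`, `(0,1)`, listed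
counterclockwise. -/
def pentagon (k : ℤ) (hk : 0 < k) : LatticePolygon where
  numVertices := 5
  three_le := by norm_num
  vertex := (![(0, 0), (1, 0), (k + 1, 1), (1, 2), (0, 1)] : Fin 5 → ℤ × ℤ)
  convex := by
    intro (i : Fin 5) (j : Fin 5)
    change j ≠ i → j ≠ i + 1 → 0 < det
      ((![(0, 0), (1, 0), (k + 1, 1), (1, 2), (0, 1)] : Fin 5 → ℤ × ℤ) (i + 1) -
        (![(0, 0), (1, 0), (k + 1, 1), (1, 2), (0, 1)] : Fin 5 → ℤ × ℤ) i)
      ((![(0, 0), (1, 0), (k + 1, 1), (1, 2), (0, 1)] : Fin 5 → ℤ × ℤ) j -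
        (![(0, 0), (1, 0), (k + 1, 1), (1, 2), (0, 1)] : Fin 5 → ℤ × ℤ) i)
    fin_cases i <;> fin_cases j <;> simp [det] <;> omega

end ToricDimer

namespace ToricDimer

open Filter Topology

/-! ### Heights of lines on the universal cover -/

/-! Both obstructions reduce to one local condition, `SelectsLeft`: a property of cells that holds,
at every crossing, for the cell on the left of both lines and fails for the two cells on the left of
only one. For an admissible arrangement the property is being counterclockwise
(`IsAdmissible.selectsLeft`); for a bipartite index graph it is having odd index
(`IsIndexMap.selectsLeft`).

The condition forces the crossings along each line to alternate in sign. The cell on the left of a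
segment between neighbouring crossings lies on the left of both transversal lines or on the right of
both, so one of them is crossed from right to left and the other from left to right
(`SelectsLeft.det_mul_det_neg`). Hence two crossings of equal sign are separated by one of the
opposite sign (`SelectsLeft.exists_crossing_between`).

An arrangement dual to the pentagon consists of one line for each edge, `a`, ..., `e`. On `e` the
negative crossings are `k` equally spaced ones with `b` and one with `a`; the positive ones are `k`
equally spaced ones with `c` and one with `d`. Two consecutive crossings with `b` enclose the one
with `a`, and both separations around it cannot come from `c`, so `d` meets `e` at distance less
than `1 / k` from `a` (`exists_near`). Thus `a` and `e` also meet `d` at distance less than `1 / k`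
from each other.

On `d` the positive crossings are the `k + 1` equally spaced ones with `c`, so a gap between
consecutive ones contains at most one negative crossing, and a gap with `a` or `e` contains no
crossing with `b`. These two gaps are adjacent or have a single gap between them. The `k - 1`
equally spaced crossings with `b` are too dense to avoid both of them when `k ≥ 5`
(`not_selectsLeft`). -/

/-- The covering map of the torus. -/
def toTorus (x : ℝ × ℝ) : Torus := ((x.1 : UnitAddCircle), (x.2 : UnitAddCircle))

/-- The point `x + t v` of the plane. -/
def shift (x : ℝ × ℝ) (v : ℤ × ℤ) (t : ℝ) : ℝ × ℝ := (x.1 + t * v.1, x.2 + t * v.2)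

theorem move_toTorus (x : ℝ × ℝ) (v : ℤ × ℤ) (t : ℝ) :
    move (toTorus x) v t = toTorus (shift x v t) := by
  simp [move, toTorus, shift]

theorem isOpenMap_toTorus : IsOpenMap toTorus :=
  (QuotientAddGroup.isOpenMap_coe (N := AddSubgroup.zmultiples (1 : ℝ))).prodMap
    (QuotientAddGroup.isOpenMap_coe (N := AddSubgroup.zmultiples (1 : ℝ)))

theorem continuous_toTorus : Continuous toTorus :=
  ((AddCircle.continuous_mk' (1 : ℝ)).comp continuous_fst).prodMk
    ((AddCircle.continuous_mk' (1 : ℝ)).comp continuous_snd)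

/-- A real number that represents the offset of a line. -/
noncomputable def OrientedLine.offsetLift (l : OrientedLine) : ℝ :=
  (QuotientAddGroup.mk_surjective l.offset).choose

theorem OrientedLine.coe_offsetLift (l : OrientedLine) :
    ((l.offsetLift : ℝ) : UnitAddCircle) = l.offset :=
  (QuotientAddGroup.mk_surjective l.offset).choose_spec

/-- The affine function on the plane that is integral exactly on the preimage of the line `l`. -/
noncomputable def height (l : OrientedLine) (x : ℝ × ℝ) : ℝ :=
  l.dir.1 * x.2 - l.dir.2 * x.1 - l.offsetLift

theorem height_shift (l : OrientedLine) (x : ℝ × ℝ) (v : ℤ × ℤ) (t : ℝ) :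
    height l (shift x v t) = height l x + t * (det l.dir v : ℤ) := by
  simp only [height, shift, det]
  push_cast
  ring

theorem continuous_height (l : OrientedLine) : Continuous (height l) := by
  unfold height
  fun_prop

theorem toTorus_mem_carrier {l : OrientedLine} {x : ℝ × ℝ} :
    toTorus x ∈ l.carrier ↔ ∃ z : ℤ, (z : ℝ) = height l x := by
  have e : ((height l x : ℝ) : UnitAddCircle)
      = l.dir.1 • ((x.2 : ℝ) : UnitAddCircle) - l.dir.2 • ((x.1 : ℝ) : UnitAddCircle)
        - l.offset := by
    rw [← l.coe_offsetLift, ← AddCircle.coe_zsmul, ← AddCircle.coe_zsmul, ← AddCircle.coe_sub,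
      ← AddCircle.coe_sub, zsmul_eq_mul, zsmul_eq_mul, height]
  have h := AddCircle.coe_eq_zero_iff (1 : ℝ) (x := height l x)
  rw [e, sub_eq_zero] at h
  simpa [OrientedLine.carrier, toTorus] using h

theorem det_swap (v w : ℤ × ℤ) : det v w = -det w v := by
  simp only [det]
  ring

theorem det_self (v : ℤ × ℤ) : det v v = 0 := by
  simp only [det]
  ring

theorem OrientedLine.det_rotM_symm_pos (l : OrientedLine) : 0 < det l.dir (rotM.symm l.dir) := by
  have h : det l.dir (rotM.symm l.dir) = l.dir.1 ^ 2 + l.dir.2 ^ 2 := by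
    simp [det, rotM]
    ring
  rw [h]
  obtain ⟨a, b, hab⟩ := l.primitive
  by_contra hn
  have h1 : l.dir.1 = 0 := by nlinarith [sq_nonneg l.dir.1, sq_nonneg l.dir.2]
  have h2 : l.dir.2 = 0 := by nlinarith [sq_nonneg l.dir.1, sq_nonneg l.dir.2]
  simp [h1, h2] at hab

theorem OrientedLine.det_rotM_neg (l : OrientedLine) : det l.dir (rotM l.dir) < 0 := by
  have h : det l.dir (rotM l.dir) = -det l.dir (rotM.symm l.dir) := by
    simp [det, rotM]
    ring
  have := l.det_rotM_symm_pos
  omega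

/-! ### Cells as images of convex polygons -/

/-- The open convex polygon on which the integral part of the height of every line `m` of the
arrangement is `n m`. -/
def polyCell (H : Arrangement) (n : OrientedLine → ℤ) : Set (ℝ × ℝ) :=
  {x | ∀ m ∈ H, (n m : ℝ) < height m x ∧ height m x < n m + 1}

/-- The cell that contains the image of `polyCell H n`, if this polygon is nonempty. -/
def cellOf (H : Arrangement) (n : OrientedLine → ℤ) : Set Torus :=
  ⋃ x ∈ polyCell H n, connectedComponentIn (support H)ᶜ (toTorus x)

section

variable {H : Arrangement} {n : OrientedLine → ℤ} {x y : ℝ × ℝ} {P : Set Torus}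

theorem not_int_of_between {a : ℝ} {z w : ℤ} (h : (z : ℝ) < a ∧ a < z + 1) : (w : ℝ) ≠ a := by
  rintro rfl
  have h1 : z < w := by exact_mod_cast h.1
  have h2 : w < z + 1 := by exact_mod_cast h.2
  omega

theorem toTorus_mem_support_compl (hx : x ∈ polyCell H n) : toTorus x ∈ (support H)ᶜ := by
  simp only [support, Set.mem_compl_iff, Set.mem_iUnion, not_exists]
  intro m hm hc
  obtain ⟨z, hz⟩ := toTorus_mem_carrier.1 hc
  exact not_int_of_between (hx m hm) hz

theorem convex_polyCell : Convex ℝ (polyCell H n) := by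
  intro x hx y hy a b ha hb hab m hm
  have e : height m (a • x + b • y) = a * height m x + b * height m y := by
    simp only [height, Prod.fst_add, Prod.snd_add, Prod.smul_fst, Prod.smul_snd, smul_eq_mul]
    linear_combination (-m.offsetLift) * (-hab)
  obtain ⟨h1, h2⟩ := hx m hm
  obtain ⟨h3, h4⟩ := hy m hm
  rw [e]
  have hb' : b = 1 - a := by linarith
  subst hb'
  rcases ha.eq_or_lt with rfl | ha
  · simp [h3, h4]
  · constructor <;> nlinarith

theorem toTorus_mem_connectedComponentIn (hx : x ∈ polyCell H n) (hy : y ∈ polyCell H n) :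
    toTorus y ∈ connectedComponentIn (support H)ᶜ (toTorus x) := by
  have hc : IsPreconnected (toTorus '' polyCell H n) :=
    convex_polyCell.isPreconnected.image _ continuous_toTorus.continuousOn
  refine hc.subset_connectedComponentIn ⟨x, hx, rfl⟩ ?_ ⟨y, hy, rfl⟩
  rintro _ ⟨z, hz, rfl⟩
  exact toTorus_mem_support_compl hz

theorem cellOf_eq (hx : x ∈ polyCell H n) :
    cellOf H n = connectedComponentIn (support H)ᶜ (toTorus x) := by
  refine Set.Subset.antisymm (Set.iUnion₂_subset fun y hy => ?_)
    (Set.subset_iUnion₂_of_subset x hx subset_rfl)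
  rw [connectedComponentIn_eq (toTorus_mem_connectedComponentIn hx hy)]

theorem isCell_cellOf (hx : x ∈ polyCell H n) : IsCell H (cellOf H n) :=
  ⟨toTorus x, toTorus_mem_support_compl hx, cellOf_eq hx⟩

theorem toTorus_mem_cellOf (hx : x ∈ polyCell H n) : toTorus x ∈ cellOf H n := by
  rw [cellOf_eq hx]
  exact mem_connectedComponentIn (toTorus_mem_support_compl hx)

theorem IsCell.eq_cellOf (hP : IsCell H P) (hx : x ∈ polyCell H n) (hxP : toTorus x ∈ P) :
    P = cellOf H n := by
  obtain ⟨θ, -, rfl⟩ := hP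
  rw [cellOf_eq hx, connectedComponentIn_eq hxP]

theorem IsCell.subset (hP : IsCell H P) : P ⊆ (support H)ᶜ := by
  obtain ⟨θ, -, rfl⟩ := hP
  exact connectedComponentIn_subset _ _

/-- Inequalities that are strict at `x` persist by continuity. Where the height equals one of the
bounds, its rate of change `det m.dir v` must point into the polygon. -/
theorem eventually_shift_mem_polyCell {v : ℤ × ℤ}
    (h : ∀ m ∈ H, ((n m : ℝ) < height m x ∧ height m x < n m + 1) ∨
      (height m x = n m ∧ 0 < det m.dir v) ∨ (height m x = n m + 1 ∧ det m.dir v < 0)) :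
    ∀ᶠ t in 𝓝[>] (0 : ℝ), shift x v t ∈ polyCell H n := by
  simp only [polyCell, Set.mem_ofPred_eq, Filter.eventually_all_finset]
  intro m hm
  have hc : Tendsto (fun t : ℝ => height m x + t * (det m.dir v : ℤ)) (𝓝[>] 0)
      (𝓝 (height m x)) := by
    have : Continuous (fun t : ℝ => height m x + t * (det m.dir v : ℤ)) := by fun_prop
    simpa using (this.tendsto 0).mono_left nhdsWithin_le_nhds
  have hpos : ∀ᶠ t in 𝓝[>] (0 : ℝ), 0 < t := self_mem_nhdsWithin
  rcases h m hm with ⟨h1, h2⟩ | ⟨h1, h2⟩ | ⟨h1, h2⟩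
  · filter_upwards [hc.eventually (lt_mem_nhds h1), hc.eventually (gt_mem_nhds h2)] with t ht1 ht2
    rw [height_shift]
    exact ⟨ht1, ht2⟩
  · have h2' : (0 : ℝ) < (det m.dir v : ℤ) := by exact_mod_cast h2
    filter_upwards [hc.eventually (gt_mem_nhds (show height m x < n m + 1 by linarith)),
      hpos] with t ht1 ht2
    rw [height_shift]
    exact ⟨by nlinarith, ht1⟩
  · have h2' : ((det m.dir v : ℤ) : ℝ) < 0 := by exact_mod_cast h2
    filter_upwards [hc.eventually (lt_mem_nhds (show (n m : ℝ) < height m x by linarith)),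
      hpos] with t ht1 ht2
    rw [height_shift]
    exact ⟨ht1, by nlinarith⟩

theorem isCell_and_liesInDirection {v : ℤ × ℤ}
    (h : ∀ m ∈ H, ((n m : ℝ) < height m x ∧ height m x < n m + 1) ∨
      (height m x = n m ∧ 0 < det m.dir v) ∨ (height m x = n m + 1 ∧ det m.dir v < 0)) :
    IsCell H (cellOf H n) ∧ LiesInDirection (cellOf H n) (toTorus x) v := by
  have he := eventually_shift_mem_polyCell h
  obtain ⟨t, ht⟩ := he.exists
  refine ⟨isCell_cellOf ht, ?_⟩
  filter_upwards [he] with t ht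
  rw [move_toTorus]
  exact toTorus_mem_cellOf ht

/-! ### Edges -/

open Classical in
/-- The vector of integral parts `n`, lowered by one at the line `l`. -/
noncomputable def lower (n : OrientedLine → ℤ) (l : OrientedLine) : OrientedLine → ℤ :=
  Function.update n l (n l - 1)

theorem lower_self (n : OrientedLine → ℤ) (l : OrientedLine) : lower n l l = n l - 1 := by
  simp [lower]

theorem lower_of_ne {l m : OrientedLine} (n : OrientedLine → ℤ) (h : m ≠ l) :
    lower n l m = n m := by
  simp [lower, h]

/-- The point `y` lies on an edge of the line `l`, with the polygon of `n` on its left. -/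
def IsEdgePoint (H : Arrangement) (l : OrientedLine) (n : OrientedLine → ℤ) (y : ℝ × ℝ) : Prop :=
  height l y = n l ∧ ∀ m ∈ H, m ≠ l → (n m : ℝ) < height m y ∧ height m y < n m + 1

variable {l l' : OrientedLine}

theorem IsEdgePoint.mem_smoothPart (hy : IsEdgePoint H l n y) : toTorus y ∈ smoothPart H l := by
  refine ⟨toTorus_mem_carrier.2 ⟨_, hy.1.symm⟩, ?_⟩
  simp only [Set.mem_iUnion, not_exists]
  rintro m ⟨hm, hml⟩ hc
  obtain ⟨z, hz⟩ := toTorus_mem_carrier.1 hc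
  exact not_int_of_between (hy.2 m hm hml) hz

theorem IsEdgePoint.left (hy : IsEdgePoint H l n y) :
    IsCell H (cellOf H n) ∧ LiesLeft (cellOf H n) l (toTorus y) := by
  refine isCell_and_liesInDirection fun m hm => ?_
  by_cases hml : m = l
  · subst hml
    exact .inr (.inl ⟨hy.1, m.det_rotM_symm_pos⟩)
  · exact .inl (hy.2 m hm hml)

theorem IsEdgePoint.right (hy : IsEdgePoint H l n y) :
    IsCell H (cellOf H (lower n l)) ∧ LiesRight (cellOf H (lower n l)) l (toTorus y) := by
  refine isCell_and_liesInDirection fun m hm => ?_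
  by_cases hml : m = l
  · subst hml
    refine .inr (.inr ⟨?_, m.det_rotM_neg⟩)
    rw [lower_self, hy.1]
    push_cast
    ring
  · rw [lower_of_ne n hml]
    exact .inl (hy.2 m hm hml)

/-- Near `y` only `l` cuts the plane, and its two sides lie in the polygons of `n` and `lower n l`.
The covering map is open, so a cell with `y` in its closure meets the image of one of these sides.
-/
theorem IsEdgePoint.eq_of_mem_frontier (hy : IsEdgePoint H l n y) (hl : l ∈ H) (hP : IsCell H P)
    (hf : toTorus y ∈ frontier P) : P = cellOf H n ∨ P = cellOf H (lower n l) := by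
  -- The lower bound is relaxed by one for `l` alone, so that `U` contains both sides of `l`.
  let U : Set (ℝ × ℝ) := {z | ∀ m ∈ H, (m ≠ l → (n m : ℝ) < height m z) ∧
    (m = l → (n m : ℝ) - 1 < height m z) ∧ height m z < n m + 1}
  have hU : U ∈ 𝓝 y := by
    change ∀ᶠ z in 𝓝 y, ∀ m ∈ H, (m ≠ l → (n m : ℝ) < height m z) ∧
      (m = l → (n m : ℝ) - 1 < height m z) ∧ height m z < n m + 1
    rw [Filter.eventually_all_finset]
    intro m hm
    have hc := (continuous_height m).tendsto y
    by_cases hml : m = l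
    · subst hml
      filter_upwards [hc.eventually (lt_mem_nhds (show (n m : ℝ) - 1 < _ by linarith [hy.1])),
        hc.eventually (gt_mem_nhds (show _ < (n m : ℝ) + 1 by linarith [hy.1]))] with z h1 h2
      exact ⟨fun h => absurd rfl h, fun _ => h1, h2⟩
    · obtain ⟨h1, h2⟩ := hy.2 m hm hml
      filter_upwards [hc.eventually (lt_mem_nhds h1), hc.eventually (gt_mem_nhds h2)] with z h1 h2
      exact ⟨fun _ => h1, fun h => absurd h hml, h2⟩
  obtain ⟨_, ⟨z, hz, rfl⟩, hzP⟩ :=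
    mem_closure_iff_nhds.1 (frontier_subset_closure hf) _ (isOpenMap_toTorus.image_mem_nhds hU)
  have hne : height l z ≠ n l := by
    intro h
    refine hP.subset hzP ?_
    simp only [support, Set.mem_iUnion]
    exact ⟨l, hl, toTorus_mem_carrier.2 ⟨_, h.symm⟩⟩
  rcases hne.lt_or_gt with hlt | hgt
  · refine .inr (hP.eq_cellOf (fun m hm => ?_) hzP)
    obtain ⟨h1, h2, h3⟩ := hz m hm
    by_cases hml : m = l
    · subst hml
      rw [lower_self]
      push_cast
      exact ⟨h2 rfl, by linarith⟩
    · rw [lower_of_ne n hml]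
      exact ⟨h1 hml, h3⟩
  · refine .inl (hP.eq_cellOf (fun m hm => ?_) hzP)
    obtain ⟨h1, h2, h3⟩ := hz m hm
    by_cases hml : m = l
    · subst hml
      exact ⟨hgt, h3⟩
    · exact ⟨h1 hml, h3⟩

/-! ### Crossings -/

/-- The lines `l` and `l'` cross at the point `x`, and no other line passes through `x`; the polygon
of `n` lies on the left of both lines. -/
structure IsCrossing (H : Arrangement) (l l' : OrientedLine) (n : OrientedLine → ℤ)
    (x : ℝ × ℝ) : Prop where
  mem_left : l ∈ H
  mem_right : l' ∈ H
  det_ne : det l.dir l'.dir ≠ 0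
  height_left : height l x = n l
  height_right : height l' x = n l'
  between : ∀ m ∈ H, m ≠ l → m ≠ l' → (n m : ℝ) < height m x ∧ height m x < n m + 1

theorem IsCrossing.symm (h : IsCrossing H l l' n x) : IsCrossing H l' l n x where
  mem_left := h.mem_right
  mem_right := h.mem_left
  det_ne := by
    rw [det_swap]
    exact neg_ne_zero.2 h.det_ne
  height_left := h.height_right
  height_right := h.height_left
  between m hm h1 h2 := h.between m hm h2 h1

theorem IsCrossing.ne (h : IsCrossing H l l' n x) : l ≠ l' := by
  rintro rfl
  exact h.det_ne (det_self _)

theorem det_neg_right (v w : ℤ × ℤ) : det v (-w) = -det v w := by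
  simp only [det, Prod.fst_neg, Prod.snd_neg]
  ring

/-- A point of the line `l` near a crossing with `l'`, on the left or right of `l'`, is reached
from the crossing along `l` or against it. -/
theorem IsCrossing.exists_isEdgePoint_of_dir (h : IsCrossing H l l' n x) {n' : OrientedLine → ℤ}
    {v : ℤ × ℤ} (hv : det l.dir v = 0) (hn : ∀ m ≠ l', n' m = n m)
    (hv' : (n' l' = n l' ∧ 0 < det l'.dir v) ∨ (n' l' = n l' - 1 ∧ det l'.dir v < 0)) :
    ∃ y, IsEdgePoint H l n' y := by
  classical
  -- Moving along `l` keeps its height at the integer `n l`, so strict bounds are only asked of the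
  -- other lines.
  have he := eventually_shift_mem_polyCell (H := H.filter (fun m => m ≠ l)) (n := n') (x := x)
    (v := v) (by
      intro m hm
      rw [Finset.mem_filter] at hm
      by_cases hml : m = l'
      · subst hml
        rcases hv' with ⟨h1, h2⟩ | ⟨h1, h2⟩
        · exact .inr (.inl ⟨by rw [h1, h.height_right], h2⟩)
        · exact .inr (.inr ⟨by rw [h1, h.height_right]; push_cast; ring, h2⟩)
      · rw [hn m hml]
        exact .inl (h.between m hm.1 hm.2 hml))
  obtain ⟨t, ht⟩ := he.exists
  refine ⟨shift x v t, ?_, fun m hm hml => ht m (Finset.mem_filter.2 ⟨hm, hml⟩)⟩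
  rw [height_shift, hv, hn l h.ne, h.height_left]
  simp

theorem IsCrossing.exists_isEdgePoint (h : IsCrossing H l l' n x) : ∃ y, IsEdgePoint H l n y := by
  have hd := h.symm.det_ne
  rcases hd.lt_or_gt with hd | hd
  · exact h.exists_isEdgePoint_of_dir (v := -l.dir) (by rw [det_neg_right, det_self, neg_zero])
      (fun _ _ => rfl) (.inl ⟨rfl, by rw [det_neg_right]; omega⟩)
  · exact h.exists_isEdgePoint_of_dir (v := l.dir) (det_self _) (fun _ _ => rfl) (.inl ⟨rfl, hd⟩)

theorem IsCrossing.exists_isEdgePoint_lower (h : IsCrossing H l l' n x) :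
    ∃ y, IsEdgePoint H l (lower n l') y := by
  have hd := h.symm.det_ne
  rcases hd.lt_or_gt with hd | hd
  · exact h.exists_isEdgePoint_of_dir (v := l.dir) (det_self _)
      (fun _ => lower_of_ne n) (.inr ⟨lower_self _ _, hd⟩)
  · exact h.exists_isEdgePoint_of_dir (v := -l.dir) (by rw [det_neg_right, det_self, neg_zero])
      (fun _ => lower_of_ne n) (.inr ⟨lower_self _ _, by rw [det_neg_right]; omega⟩)

/-- A property of polygons that distinguishes, at every crossing, the cell on the left of both
lines from the cells on the left of only one of them. -/
def SelectsLeft (H : Arrangement) (G : (OrientedLine → ℤ) → Prop) : Prop :=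
  ∀ l l' n x, IsCrossing H l l' n x → G n ∧ ¬ G (lower n l')

/-- The edge of `l` that leaves the crossing on the left of `l'` must bound an oriented cell. The
cell to its right lies on the right of `l` but on the left of `l'`, so it is not oriented; the cell
to its left must then be oriented, hence counterclockwise. -/
theorem IsAdmissible.selectsLeft (hH : IsAdmissible H) :
    SelectsLeft H (fun n => IsCounterclockwise H (cellOf H n)) := by
  intro l l' n x h
  obtain ⟨y, hy⟩ := h.exists_isEdgePoint
  obtain ⟨y', hy'⟩ := h.symm.exists_isEdgePoint
  obtain ⟨w, hw⟩ := h.symm.exists_isEdgePoint_lower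
  refine ⟨?_, fun hc => hc.2 l' h.mem_right _ hy'.mem_smoothPart hy'.right.2⟩
  obtain ⟨P, hP, hf⟩ := hH l h.mem_left _ ⟨toTorus y, hy.mem_smoothPart, rfl⟩
  have hfy := hf (mem_connectedComponentIn hy.mem_smoothPart)
  have hPc : IsCell H P := hP.elim (fun h => h.1) (fun h => h.1)
  rcases hy.eq_of_mem_frontier h.mem_left hPc hfy with rfl | rfl
  · exact hP.resolve_right fun hc => hc.2 l h.mem_left _ hy.mem_smoothPart hy.left.2
  · rcases hP with hc | hc
    · exact absurd hy.right.2 (hc.2 l h.mem_left _ hy.mem_smoothPart)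
    · exact absurd hw.left.2 (hc.2 l' h.mem_right _ hw.mem_smoothPart)

theorem det_add_right (v w w' : ℤ × ℤ) : det v (w + w') = det v w + det v w' := by
  simp only [det, Prod.fst_add, Prod.snd_add]
  ring

/-- If the second line crosses the first from its right to its left, then the edges of the cell on
the right of the first line and the left of the second run towards the crossing. -/
theorem IsCrossing.oppositeInOut (h : IsCrossing H l l' n x) (hd : 0 < det l.dir l'.dir) :
    OppositeInOut H (toTorus x) (cellOf H (lower n l)) (cellOf H (lower n l')) := by
  have hs := det_swap l'.dir l.dir
  have h1 : IsCell H (cellOf H (lower n l)) ∧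
      LiesInDirection (cellOf H (lower n l)) (toTorus x) (-(l.dir + l'.dir)) := by
    refine isCell_and_liesInDirection fun m hm => ?_
    by_cases hml : m = l
    · subst hml
      refine .inr (.inr ⟨by rw [lower_self, h.height_left]; push_cast; ring, ?_⟩)
      rw [det_neg_right, det_add_right, det_self]
      omega
    · rw [lower_of_ne n hml]
      by_cases hml' : m = l'
      · subst hml'
        refine .inr (.inl ⟨h.height_right, ?_⟩)
        rw [det_neg_right, det_add_right, det_self]
        omega
      · exact .inl (h.between m hm hml hml')
  have h2 : IsCell H (cellOf H (lower n l')) ∧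
      LiesInDirection (cellOf H (lower n l')) (toTorus x) (l.dir + l'.dir) := by
    refine isCell_and_liesInDirection fun m hm => ?_
    by_cases hml' : m = l'
    · subst hml'
      refine .inr (.inr ⟨by rw [lower_self, h.height_right]; push_cast; ring, ?_⟩)
      rw [det_add_right, det_self]
      omega
    · rw [lower_of_ne n hml']
      by_cases hml : m = l
      · subst hml
        refine .inr (.inl ⟨h.height_left, ?_⟩)
        rw [det_add_right, det_self]
        omega
      · exact .inl (h.between m hm hml hml')
  exact ⟨h1.1, h2.1, l, h.mem_left, l', h.mem_right, h.det_ne,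
    toTorus_mem_carrier.2 ⟨_, h.height_left.symm⟩, toTorus_mem_carrier.2 ⟨_, h.height_right.symm⟩,
    h1.2, h2.2⟩

/-- The two cells on the left of exactly one line have the same index, one more than that of the
cell on the left of both. If this common index were odd, they would be joined by a directed edge,
which a bipartite graph excludes. -/
theorem IsIndexMap.selectsLeft {ι : Set Torus → ℤ} (hι : IsIndexMap H ι)
    (hG : (indexGraph H ι).IsBipartite) : SelectsLeft H (fun n => Odd (ι (cellOf H n))) := by
  have key : ∀ l l' n x, IsCrossing H l l' n x →
      ι (cellOf H (lower n l)) = ι (cellOf H n) + 1 := by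
    intro l l' n x h
    obtain ⟨y, hy⟩ := h.exists_isEdgePoint
    exact hι l h.mem_left _ hy.mem_smoothPart _ _ hy.left.1 hy.right.1 hy.left.2 hy.right.2
  have even : ∀ l l' n x, IsCrossing H l l' n x → 0 < det l.dir l'.dir → Odd (ι (cellOf H n)) := by
    intro l l' n x h hd
    have h1 := key l l' n x h
    have h2 := key l' l n x h.symm
    by_contra ho
    have ho' : Odd (ι (cellOf H n) + 1) := (Int.not_odd_iff_even.1 ho).add_one
    have : (toTorus x, cellOf H (lower n l), cellOf H (lower n l')) ∈
        (indexGraph H ι).directed :=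
      ⟨h.oppositeInOut hd, by rwa [h1], by rwa [h2], by rw [h1, h2]⟩
    rw [hG.1] at this
    exact this
  intro l l' n x h
  have ho : Odd (ι (cellOf H n)) := by
    rcases h.det_ne.lt_or_gt with hd | hd
    · exact even l' l n x h.symm (by rw [det_swap]; omega)
    · exact even l l' n x h hd
  refine ⟨ho, ?_⟩
  change ¬ Odd (ι (cellOf H (lower n l')))
  rw [key l' l n x h.symm, Int.not_odd_iff_even]
  exact ho.add_one

end

/-! ### Crossing signs alternate along a line -/

section

variable {H : Arrangement} {G : (OrientedLine → ℤ) → Prop} {l l' l'' : OrientedLine} {x : ℝ × ℝ}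

theorem shift_shift (x : ℝ × ℝ) (v : ℤ × ℤ) (s t : ℝ) :
    shift (shift x v s) v t = shift x v (s + t) := by
  ext <;> simp only [shift] <;> ring

theorem toTorus_shift_mem_carrier {l m : OrientedLine} {x : ℝ × ℝ} {t : ℝ} :
    toTorus (shift x l.dir t) ∈ m.carrier ↔
      ∃ z : ℤ, (z : ℝ) = height m x + t * (det m.dir l.dir : ℤ) := by
  rw [toTorus_mem_carrier, height_shift]

/-- A value strictly between those at `t` and at the midpoint `T / 2` is attained strictly between
these parameters, hence inside the open interval even if `t` is an endpoint. -/
theorem exists_affine_eq {a D T t w : ℝ} (hT : 0 < T) (h0 : 0 ≤ t) (h1 : t ≤ T)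
    (hw : (a + t * D < w ∧ w < a + T / 2 * D) ∨ (a + T / 2 * D < w ∧ w < a + t * D)) :
    ∃ s, 0 < s ∧ s < T ∧ w = a + s * D := by
  have hne : (T / 2 - t) * D ≠ 0 := by
    intro h
    rcases hw with hw | hw <;> linarith [hw.1, hw.2]
  obtain ⟨c, hc⟩ : ∃ c, c = (w - (a + t * D)) / ((T / 2 - t) * D) := ⟨_, rfl⟩
  have hcw : w = a + t * D + c * ((T / 2 - t) * D) := by
    rw [hc, div_mul_cancel₀ _ hne]
    ring
  have hc01 : 0 < c ∧ c < 1 := by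
    rw [hc]
    rcases hw with ⟨h2, h3⟩ | ⟨h2, h3⟩
    · have : 0 < (T / 2 - t) * D := by linarith
      exact ⟨div_pos (by linarith) this, (div_lt_one this).2 (by linarith)⟩
    · have : (T / 2 - t) * D < 0 := by linarith
      exact ⟨div_pos_of_neg_of_neg (by linarith) this, (div_lt_one_of_neg this).2 (by linarith)⟩
  refine ⟨t + c * (T / 2 - t), ?_, ?_, ?_⟩
  · nlinarith
  · nlinarith
  · rw [hcw]
    ring

/-- An affine function without integral values on an open interval stays between two consecutive
integers. -/
theorem exists_floor_of_forall_ne {a D T : ℝ} (hT : 0 < T)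
    (h : ∀ t, 0 < t → t < T → ∀ z : ℤ, (z : ℝ) ≠ a + t * D) :
    ∃ z : ℤ, (∀ t, 0 < t → t < T → (z : ℝ) < a + t * D ∧ a + t * D < z + 1) ∧
      ∀ t, 0 ≤ t → t ≤ T → (z : ℝ) ≤ a + t * D ∧ a + t * D ≤ z + 1 := by
  have hz := Int.floor_le (a + T / 2 * D)
  have hz' := Int.lt_floor_add_one (a + T / 2 * D)
  have hz1 := lt_of_le_of_ne hz (h _ (by linarith) (by linarith) _)
  have key : ∀ t, 0 ≤ t → t ≤ T → (⌊a + T / 2 * D⌋ : ℝ) ≤ a + t * D ∧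
      a + t * D ≤ ⌊a + T / 2 * D⌋ + 1 := by
    intro t h0 h1
    constructor
    · by_contra! hlt
      obtain ⟨s, hs0, hs1, hs⟩ := exists_affine_eq hT h0 h1 (.inl ⟨hlt, hz1⟩)
      exact h s hs0 hs1 _ hs
    · by_contra! hlt
      obtain ⟨s, hs0, hs1, hs⟩ := exists_affine_eq hT h0 h1 (.inr ⟨hz', hlt⟩)
      exact h s hs0 hs1 (⌊a + T / 2 * D⌋ + 1) (by exact_mod_cast hs)
  refine ⟨_, fun t h0 h1 => ?_, key⟩
  obtain ⟨h2, h3⟩ := key t h0.le h1.le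
  refine ⟨lt_of_le_of_ne h2 (h t h0 h1 _), lt_of_le_of_ne h3 fun he => ?_⟩
  exact h t h0 h1 (⌊a + T / 2 * D⌋ + 1) (by rw [he]; push_cast; rfl)

theorem IsSimple.notMem_carrier {m : OrientedLine} {θ : Torus} (hS : IsSimple H) (hl : l ∈ H)
    (hl' : l' ∈ H) (hm : m ∈ H) (h1 : l ≠ l') (h2 : l ≠ m) (h3 : l' ≠ m) (hx : θ ∈ l.carrier)
    (hx' : θ ∈ l'.carrier) : θ ∉ m.carrier := fun hxm => by
  have : θ ∈ l.carrier ∩ l'.carrier ∩ m.carrier := ⟨⟨hx, hx'⟩, hxm⟩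
  rw [hS l hl l' hl' m hm h1 h2 h3] at this
  exact this

open Classical in
theorem lower_update_add_one (n : OrientedLine → ℤ) (l : OrientedLine) :
    lower (Function.update n l (n l + 1)) l = n := by
  simp [lower]

/-- If the polygon of `n` touches the crossing `x` and lies on the left of `l`, then it has the
selected property exactly if it also lies on the left of `l'`. -/
theorem SelectsLeft.crossing (hG : SelectsLeft H G) (hS : IsSimple H) (hl : l ∈ H) (hl' : l' ∈ H)
    (hd : det l.dir l'.dir ≠ 0) {n : OrientedLine → ℤ} (hx : height l x = n l)
    (hn : ∀ m ∈ H, m ≠ l → (n m : ℝ) ≤ height m x ∧ height m x ≤ n m + 1) :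
    (height l' x = n l' → G n) ∧ (height l' x = n l' + 1 → ¬ G n) := by
  classical
  have hne : l ≠ l' := by
    rintro rfl
    exact hd (det_self _)
  have hlt : toTorus x ∈ l'.carrier → ∀ m ∈ H, m ≠ l → m ≠ l' →
      (n m : ℝ) < height m x ∧ height m x < n m + 1 := by
    intro hx' m hm h1 h2
    have hmx := hS.notMem_carrier hl hl' hm hne h1.symm h2.symm
      (toTorus_mem_carrier.2 ⟨_, hx.symm⟩) hx'
    rw [toTorus_mem_carrier, not_exists] at hmx
    obtain ⟨h3, h4⟩ := hn m hm h1
    exact ⟨lt_of_le_of_ne h3 (hmx _), lt_of_le_of_ne h4 fun h =>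
      hmx (n m + 1) (by rw [h]; push_cast; rfl)⟩
  constructor
  · intro hx'
    exact (hG l l' n x ⟨hl, hl', hd, hx, hx', hlt (toTorus_mem_carrier.2 ⟨_, hx'.symm⟩)⟩).1
  · intro hx'
    -- Here the polygon of `n` lies on the right of `l'`. Raising `n l'` by one gives the polygon on
    -- the left of both lines, from which `n` is recovered by `lower`.
    have hc : IsCrossing H l l' (Function.update n l' (n l' + 1)) x := by
      refine ⟨hl, hl', hd, ?_, ?_, fun m hm h1 h2 => ?_⟩
      · rw [Function.update_of_ne hne, hx]
      · rw [Function.update_self, hx']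
        push_cast
        rfl
      · rw [Function.update_of_ne h2]
        exact hlt (toTorus_mem_carrier.2 ⟨n l' + 1, by rw [hx']; push_cast; rfl⟩) m hm h1 h2
    have := (hG _ _ _ _ hc).2
    rwa [lower_update_add_one] at this

/-- One polygon, the one on the left of the segment, touches both end crossings. Comparing at the
two ends whether it has the property `G` gives the alternation of signs. -/
theorem SelectsLeft.det_mul_det_neg (hG : SelectsLeft H G) (hS : IsSimple H)
    (hdet : ∀ m ∈ H, ∀ m' ∈ H, m ≠ m' → det m.dir m'.dir ≠ 0)
    (hl : l ∈ H) (hl' : l' ∈ H) (hl'' : l'' ∈ H) (h1 : l' ≠ l) (h2 : l'' ≠ l) {T : ℝ}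
    (hT : 0 < T) (hx : toTorus x ∈ l.carrier) (hx' : toTorus x ∈ l'.carrier)
    (hx'' : toTorus (shift x l.dir T) ∈ l''.carrier)
    (hno : ∀ t, 0 < t → t < T → ∀ m ∈ H, m ≠ l → toTorus (shift x l.dir t) ∉ m.carrier) :
    det l'.dir l.dir * det l''.dir l.dir < 0 := by
  obtain ⟨z, hz⟩ := toTorus_mem_carrier.1 hx
  have hex : ∀ m, ∃ z : ℤ, (m = l → (z : ℝ) = height l x) ∧ (m ∈ H → m ≠ l →
      (∀ t, 0 < t → t < T → (z : ℝ) < height m x + t * (det m.dir l.dir : ℤ) ∧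
        height m x + t * (det m.dir l.dir : ℤ) < z + 1) ∧
      ∀ t, 0 ≤ t → t ≤ T → (z : ℝ) ≤ height m x + t * (det m.dir l.dir : ℤ) ∧
        height m x + t * (det m.dir l.dir : ℤ) ≤ z + 1) := by
    intro m
    by_cases hml : m = l
    · exact ⟨z, fun _ => hz, fun _ h => absurd hml h⟩
    · by_cases hm : m ∈ H
      · obtain ⟨w, hw⟩ := exists_floor_of_forall_ne (a := height m x)
          (D := (det m.dir l.dir : ℤ)) hT fun t h0 h1 w hw =>
            hno t h0 h1 m hm hml (toTorus_shift_mem_carrier.2 ⟨w, hw⟩)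
        exact ⟨w, fun h => absurd h hml, fun _ _ => hw⟩
      -- The value off `H` is irrelevant.
      · exact ⟨0, fun h => absurd h hml, fun h => absurd h hm⟩
  choose n hn using hex
  have hlx : height l x = n l := ((hn l).1 rfl).symm
  have A := hG.crossing hS hl hl' (hdet l hl l' hl' h1.symm) hlx fun m hm hml => by
    simpa using ((hn m).2 hm hml).2 0 le_rfl hT.le
  have B := hG.crossing hS hl hl'' (hdet l hl l'' hl'' h2.symm) (x := shift x l.dir T) (n := n)
    (by rw [height_shift, det_self, hlx]; simp) fun m hm hml => by
      rw [height_shift]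
      exact ((hn m).2 hm hml).2 T hT.le le_rfl
  obtain ⟨w', hw'⟩ := toTorus_mem_carrier.1 hx'
  obtain ⟨w'', hw''⟩ := toTorus_shift_mem_carrier.1 hx''
  obtain ⟨C1, C2⟩ := ((hn l').2 hl' h1).1 (T / 2) (by linarith) (by linarith)
  obtain ⟨C3, C4⟩ := ((hn l').2 hl' h1).2 0 le_rfl hT.le
  obtain ⟨D1, D2⟩ := ((hn l'').2 hl'' h2).1 (T / 2) (by linarith) (by linarith)
  obtain ⟨D3, D4⟩ := ((hn l'').2 hl'' h2).2 T hT.le le_rfl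
  rw [height_shift, ← hw''] at B
  have hd' := hdet l' hl' l hl h1
  have hd'' := hdet l'' hl'' l hl h2
  rw [← hw'] at A C1 C2 C3 C4
  simp only [zero_mul, add_zero] at C3 C4
  rw [← hw''] at D3 D4
  have C3' : n l' ≤ w' := by exact_mod_cast C3
  have C4' : w' ≤ n l' + 1 := by exact_mod_cast C4
  have D3' : n l'' ≤ w'' := by exact_mod_cast D3
  have D4' : w'' ≤ n l'' + 1 := by exact_mod_cast D4
  have A' : (w' = n l' → G n) ∧ (w' = n l' + 1 → ¬ G n) := by exact_mod_cast A
  have B' : (w'' = n l'' → G n) ∧ (w'' = n l'' + 1 → ¬ G n) := by exact_mod_cast B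
  -- A positive sign means that the height of the transversal increases along `l`: it starts at its
  -- lower bound, and at the far end it stops at its upper bound. This decides on which side of each
  -- transversal the polygon lies.
  have A1 : 0 < det l'.dir l.dir → w' = n l' := by
    intro h
    have h' : (0 : ℝ) < (det l'.dir l.dir : ℤ) := by exact_mod_cast h
    have : (w' : ℝ) < n l' + 1 := by nlinarith
    have : w' < n l' + 1 := by exact_mod_cast this
    omega
  have A2 : det l'.dir l.dir < 0 → w' = n l' + 1 := by
    intro h
    have h' : ((det l'.dir l.dir : ℤ) : ℝ) < 0 := by exact_mod_cast h
    have : (n l' : ℝ) < w' := by nlinarith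
    have : n l' < w' := by exact_mod_cast this
    omega
  have B1 : 0 < det l''.dir l.dir → w'' = n l'' + 1 := by
    intro h
    have h' : (0 : ℝ) < (det l''.dir l.dir : ℤ) := by exact_mod_cast h
    have : (n l'' : ℝ) < w'' := by nlinarith
    have : n l'' < w'' := by exact_mod_cast this
    omega
  have B2 : det l''.dir l.dir < 0 → w'' = n l'' := by
    intro h
    have h' : ((det l''.dir l.dir : ℤ) : ℝ) < 0 := by exact_mod_cast h
    have : (w'' : ℝ) < n l'' + 1 := by nlinarith
    have : w'' < n l'' + 1 := by exact_mod_cast this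
    omega
  rcases hd'.lt_or_gt with hd' | hd' <;> rcases hd''.lt_or_gt with hd'' | hd''
  · exact absurd (B'.1 (B2 hd'')) (A'.2 (A2 hd'))
  · exact mul_neg_of_neg_of_pos hd' hd''
  · exact mul_neg_of_pos_of_neg hd' hd''
  · exact absurd (A'.1 (A1 hd')) (B'.2 (B1 hd''))

theorem finite_setOf_affine_int {a D : ℝ} (hD : D ≠ 0) (s t : ℝ) :
    {r : ℝ | s < r ∧ r ≤ t ∧ ∃ z : ℤ, (z : ℝ) = a + r * D}.Finite := by
  refine ((Set.finite_Icc (⌊min (a + s * D) (a + t * D)⌋) (⌈max (a + s * D) (a + t * D)⌉)).image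
    (fun z : ℤ => (z - a) / D)).subset ?_
  rintro r ⟨h1, h2, z, hz⟩
  refine ⟨z, ⟨?_, ?_⟩, ?_⟩
  · rw [← Int.cast_le (R := ℝ), hz]
    refine (Int.floor_le _).trans ?_
    rcases hD.lt_or_gt with hD | hD
    · exact (min_le_right _ _).trans (by nlinarith)
    · exact (min_le_left _ _).trans (by nlinarith)
  · rw [← Int.cast_le (R := ℝ), hz]
    refine le_trans ?_ (Int.le_ceil _)
    rcases hD.lt_or_gt with hD | hD
    · exact le_trans (by nlinarith) (le_max_left _ _)
    · exact le_trans (by nlinarith) (le_max_right _ _)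
  · simp only [hz]
    field_simp
    ring

/-- Between two crossings of the same sign on a line there is a crossing of the opposite sign. -/
theorem SelectsLeft.exists_crossing_between (hG : SelectsLeft H G) (hS : IsSimple H)
    (hdet : ∀ m ∈ H, ∀ m' ∈ H, m ≠ m' → det m.dir m'.dir ≠ 0)
    (hl : l ∈ H) (hl' : l' ∈ H) (hl'' : l'' ∈ H) (h1 : l' ≠ l) (h2 : l'' ≠ l)
    (hx : toTorus x ∈ l.carrier) {s t : ℝ} (hst : s < t)
    (hs : toTorus (shift x l.dir s) ∈ l'.carrier) (ht : toTorus (shift x l.dir t) ∈ l''.carrier)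
    (hd : 0 < det l'.dir l.dir * det l''.dir l.dir) :
    ∃ r, s < r ∧ r < t ∧ ∃ m ∈ H, toTorus (shift x l.dir r) ∈ m.carrier ∧
      det l'.dir l.dir * det m.dir l.dir < 0 := by
  have hxl : ∀ r, toTorus (shift x l.dir r) ∈ l.carrier := by
    intro r
    rw [toTorus_shift_mem_carrier, det_self]
    simpa [toTorus_mem_carrier] using hx
  let S : Set ℝ := {r | s < r ∧ r ≤ t ∧ ∃ m ∈ H, m ≠ l ∧ toTorus (shift x l.dir r) ∈ m.carrier}
  have hSf : S.Finite := by
    have : S ⊆ ⋃ m ∈ {m | m ∈ H ∧ m ≠ l}, {r : ℝ | s < r ∧ r ≤ t ∧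
        ∃ z : ℤ, (z : ℝ) = height m x + r * (det m.dir l.dir : ℤ)} := by
      rintro r ⟨h3, h4, m, hm, hml, hr⟩
      simp only [Set.mem_iUnion]
      exact ⟨m, ⟨hm, hml⟩, h3, h4, toTorus_shift_mem_carrier.1 hr⟩
    refine Set.Finite.subset (Set.Finite.biUnion (H.finite_toSet.subset fun m hm => hm.1) ?_) this
    rintro m ⟨hm, hml⟩
    exact finite_setOf_affine_int (by exact_mod_cast hdet m hm l hl hml) s t
  -- The first crossing after `s` is adjacent to it, so it has the opposite sign.
  obtain ⟨r, ⟨h3, h4, m, hm, hml, hr⟩, hmin⟩ :=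
    Set.exists_min_image S id hSf ⟨t, hst, le_rfl, l'', hl'', h2, ht⟩
  have hneg : det l'.dir l.dir * det m.dir l.dir < 0 := by
    refine hG.det_mul_det_neg hS hdet hl hl' hm h1 hml (sub_pos.2 h3) (hxl s) hs ?_ ?_
    · rw [shift_shift, add_sub_cancel]
      exact hr
    · intro q hq0 hq1 m' hm' hml' hc
      rw [shift_shift] at hc
      have : r ≤ s + q := hmin (s + q) ⟨by linarith, by linarith, m', hm', hml', hc⟩
      linarith
  refine ⟨r, h3, lt_of_le_of_ne h4 ?_, m, hm, hr, hneg⟩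
  rintro rfl
  by_cases hmm : m = l''
  · subst hmm
    omega
  · exact hS.notMem_carrier hl hm hl'' hml.symm h2.symm hmm (hxl _) hr ht

end

/-! ### Arrangements dual to the pentagon -/

/-- The arrangement dual to a polygon with primitive facets has a unique line for every facet. -/
theorem IsDual.exists_line {H : Arrangement} {N : LatticePolygon} (hD : IsDual H N)
    (hN : ∀ i, IsCoprime (N.facet i).1 (N.facet i).2) :
    (∀ i, ∃ l ∈ H, l.dir = rotM (N.facet i)) ∧ (∀ l ∈ H, ∃ i, l.dir = rotM (N.facet i)) ∧
      ∀ l ∈ H, ∀ l' ∈ H, l.dir = l'.dir → l = l' := by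
  obtain ⟨e, he⟩ := hD
  have key : ∀ d, (H.filter (fun l => l.dir = d.1)).card = 1 ∧ d.1 = rotM (N.facet (e d)) := by
    intro d
    have h := he d
    have hs : ∑ l ∈ H.filter (fun l => l.dir = d.1), l.dir
        = (H.filter (fun l => l.dir = d.1)).card • d.1 := by
      rw [← Finset.sum_const]
      exact Finset.sum_congr rfl fun l hl => (Finset.mem_filter.1 hl).2
    rw [hHat, hs, AddEquiv.symm_apply_eq] at h
    have h1 := congrArg Prod.fst h
    have h2 := congrArg Prod.snd h
    obtain ⟨u, v, huv⟩ := hN (e d)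
    simp only [rotM, AddEquiv.coe_mk, Equiv.coe_fn_mk, Prod.smul_fst, Prod.smul_snd] at h1 h2
    rw [nsmul_eq_mul] at h1 h2
    -- The facet is the rotated class direction times the number of lines in the class; a Bézout
    -- relation for the primitive facet makes this number divide `1`.
    have hdvd : ((H.filter (fun l => l.dir = d.1)).card : ℤ) ∣ 1 :=
      ⟨v * d.1.1 - u * d.1.2, by linear_combination -huv - v * h1 + u * h2⟩
    have hc : (H.filter (fun l => l.dir = d.1)).card = 1 := by
      have := Int.natCast_dvd_natCast.1 (by simpa using hdvd :
        ((H.filter (fun l => l.dir = d.1)).card : ℤ) ∣ ((1 : ℕ) : ℤ))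
      exact Nat.dvd_one.1 this
    rw [hc, one_smul] at h
    exact ⟨hc, h⟩
  refine ⟨fun i => ?_, fun l hl => ?_, fun l hl l' hl' hll => ?_⟩
  · obtain ⟨l, hl, hld⟩ := Finset.mem_image.1 (e.symm i).2
    refine ⟨l, hl, ?_⟩
    rw [hld, (key (e.symm i)).2, e.apply_symm_apply]
  · exact ⟨_, (key ⟨l.dir, Finset.mem_image_of_mem _ hl⟩).2⟩
  · have := (key ⟨l'.dir, Finset.mem_image_of_mem _ hl'⟩).1
    exact Finset.card_le_one.1 this.le l (Finset.mem_filter.2 ⟨hl, hll⟩) l'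
      (Finset.mem_filter.2 ⟨hl', rfl⟩)

/-- The five lines `a`, `b`, `c`, `d`, `e` of an arrangement dual to the pentagon. -/
structure IsPentagonArrangement (k : ℤ) (H : Arrangement) (a b c d e : OrientedLine) : Prop where
  a_mem : a ∈ H
  b_mem : b ∈ H
  c_mem : c ∈ H
  d_mem : d ∈ H
  e_mem : e ∈ H
  a_dir : a.dir = (0, -1)
  b_dir : b.dir = (1, -k)
  c_dir : c.dir = (1, k)
  d_dir : d.dir = (-1, 1)
  e_dir : e.dir = (-1, 0)
  eq_or : ∀ m ∈ H, m = a ∨ m = b ∨ m = c ∨ m = d ∨ m = e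

theorem IsDual.exists_isPentagonArrangement {k : ℤ} {hk : 0 < k} {H : Arrangement}
    (hD : IsDual H (pentagon k hk)) : ∃ a b c d e, IsPentagonArrangement k H a b c d e := by
  have f0 : (pentagon k hk).facet (0 : Fin 5) = (1, 0) := by
    change (1, 0) - (0, 0) = _
    simp
  have f1 : (pentagon k hk).facet (1 : Fin 5) = (k, 1) := by
    change (k + 1, 1) - (1, 0) = _
    simp
  have f2 : (pentagon k hk).facet (2 : Fin 5) = (-k, 1) := by
    change (1, 2) - (k + 1, 1) = _
    simp
  have f3 : (pentagon k hk).facet (3 : Fin 5) = (-1, -1) := by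
    change (0, 1) - (1, 2) = _
    simp
  have f4 : (pentagon k hk).facet (4 : Fin 5) = (0, -1) := by
    change (0, 0) - (0, 1) = _
    simp
  have hcases : ∀ i : ZMod (pentagon k hk).numVertices,
      i = (0 : Fin 5) ∨ i = (1 : Fin 5) ∨ i = (2 : Fin 5) ∨ i = (3 : Fin 5) ∨ i = (4 : Fin 5) := by
    intro (i : Fin 5)
    change i = 0 ∨ i = 1 ∨ i = 2 ∨ i = 3 ∨ i = 4
    omega
  obtain ⟨h1, h2, h3⟩ := hD.exists_line (by
    intro i
    rcases hcases i with rfl | rfl | rfl | rfl | rfl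
    · rw [f0]
      exact isCoprime_one_left
    · rw [f1]
      exact isCoprime_one_right
    · rw [f2]
      exact isCoprime_one_right
    · rw [f3]
      exact isCoprime_one_left.neg_left
    · rw [f4]
      exact isCoprime_one_right.neg_right)
  obtain ⟨a, ha, ha'⟩ := h1 (0 : Fin 5)
  obtain ⟨b, hb, hb'⟩ := h1 (1 : Fin 5)
  obtain ⟨c, hc, hc'⟩ := h1 (2 : Fin 5)
  obtain ⟨d, hd, hd'⟩ := h1 (3 : Fin 5)
  obtain ⟨e, he, he'⟩ := h1 (4 : Fin 5)
  refine ⟨a, b, c, d, e, ha, hb, hc, hd, he, ?_, ?_, ?_, ?_, ?_, fun m hm => ?_⟩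
  · rw [ha', f0]
    rfl
  · rw [hb', f1]
    rfl
  · rw [hc', f2]
    simp [rotM]
  · rw [hd', f3]
    rfl
  · rw [he', f4]
    simp [rotM]
  · obtain ⟨i, hi⟩ := h2 m hm
    rcases hcases i with rfl | rfl | rfl | rfl | rfl
    · exact .inl (h3 m hm a ha (hi.trans ha'.symm))
    · exact .inr (.inl (h3 m hm b hb (hi.trans hb'.symm)))
    · exact .inr (.inr (.inl (h3 m hm c hc (hi.trans hc'.symm))))
    · exact .inr (.inr (.inr (.inl (h3 m hm d hd (hi.trans hd'.symm)))))
    · exact .inr (.inr (.inr (.inr (h3 m hm e he (hi.trans he'.symm)))))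

/-! ### Crossings on the lines `e` and `d` of the pentagon arrangement -/

namespace IsPentagonArrangement

variable {k : ℤ} {H : Arrangement} {a b c d e : OrientedLine}
  {G : (OrientedLine → ℤ) → Prop}

theorem det_ne_zero (h : IsPentagonArrangement k H a b c d e) (hk : 5 ≤ k) :
    ∀ m ∈ H, ∀ m' ∈ H, m ≠ m' → det m.dir m'.dir ≠ 0 := by
  intro m hm m' hm' hne
  rcases h.eq_or m hm with rfl | rfl | rfl | rfl | rfl <;>
    rcases h.eq_or m' hm' with rfl | rfl | rfl | rfl | rfl <;>
    first
    | exact absurd rfl hne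
    | (simp only [det, h.a_dir, h.b_dir, h.c_dir, h.d_dir, h.e_dir]; omega)

/-- The lines `a` and `d` meet the line `e` at distance less than `1 / k`. -/
theorem exists_near (h : IsPentagonArrangement k H a b c d e) (hk : 5 ≤ k) (hS : IsSimple H)
    (hG : SelectsLeft H G) :
    ∃ (δ : ℝ) (z : ℤ), z = δ - (a.offsetLift + d.offsetLift - e.offsetLift) ∧
      -1 < k * δ ∧ k * δ < 1 := by
  have hdet := h.det_ne_zero hk
  have hkR : (5 : ℝ) ≤ k := by exact_mod_cast hk
  -- The crossing of `a` and `e`, from which positions on `e` are measured.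
  obtain ⟨x, hx⟩ : ∃ x : ℝ × ℝ, x = (a.offsetLift, -e.offsetLift) := ⟨_, rfl⟩
  have hxe : toTorus x ∈ e.carrier :=
    toTorus_mem_carrier.2 ⟨0, by simp [height, h.e_dir, hx]⟩
  have hxa : toTorus x ∈ a.carrier :=
    toTorus_mem_carrier.2 ⟨0, by simp [height, h.a_dir, hx]⟩
  have dae : det a.dir e.dir = -1 := by simp [det, h.a_dir, h.e_dir]
  have dbe : det b.dir e.dir = -k := by simp [det, h.b_dir, h.e_dir]
  have dce : det c.dir e.dir = k := by simp [det, h.c_dir, h.e_dir]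
  have dde : det d.dir e.dir = 1 := by simp [det, h.d_dir, h.e_dir]
  have hbe : b ≠ e := by
    rintro rfl
    rw [det_self] at dbe
    omega
  have hae : a ≠ e := by
    rintro rfl
    rw [det_self] at dae
    omega
  have hab : a ≠ b := by
    rintro rfl
    rw [dae] at dbe
    omega
  have hxb := hS.notMem_carrier h.a_mem h.e_mem h.b_mem hae hab hbe.symm hxa hxe
  rw [toTorus_mem_carrier, not_exists] at hxb
  have hxa0 : toTorus (shift x e.dir 0) ∈ a.carrier := by simpa [shift] using hxa
  have hd0 : height d x = e.offsetLift - a.offsetLift - d.offsetLift := by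
    simp [height, h.d_dir, hx]
  -- between two crossings of the negative sign at distance less than `1 / k`
  have key : ∀ s t, s < t → ∀ m ∈ H, ∀ m' ∈ H, det m.dir e.dir < 0 → det m'.dir e.dir < 0 →
      toTorus (shift x e.dir s) ∈ m.carrier → toTorus (shift x e.dir t) ∈ m'.carrier →
      ∃ r, s < r ∧ r < t ∧ ((∃ z : ℤ, (z : ℝ) = height c x + r * k) ∨
        ∃ z : ℤ, (z : ℝ) = r - (a.offsetLift + d.offsetLift - e.offsetLift)) := by
    intro s t hst m hm m' hm' hmd hmd' hms hmt
    have hme : m ≠ e := by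
      rintro rfl
      rw [det_self] at hmd
      omega
    have hme' : m' ≠ e := by
      rintro rfl
      rw [det_self] at hmd'
      omega
    obtain ⟨r, h1, h2, m'', hm'', hr, hneg⟩ := hG.exists_crossing_between hS hdet h.e_mem hm hm'
      hme hme' hxe hst hms hmt (mul_pos_of_neg_of_neg hmd hmd')
    have hpos : 0 < det m''.dir e.dir := by
      by_contra! hle
      nlinarith
    refine ⟨r, h1, h2, ?_⟩
    obtain ⟨z, hz⟩ := toTorus_shift_mem_carrier.1 hr
    rcases h.eq_or m'' hm'' with rfl | rfl | rfl | rfl | rfl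
    · omega
    · omega
    · exact .inl ⟨z, by rw [hz, dce]⟩
    · refine .inr ⟨z, ?_⟩
      rw [hz, dde, hd0]
      push_cast
      ring
    · rw [det_self] at hpos
      omega
  have hf := Int.floor_le (height b x)
  have hf' := Int.lt_floor_add_one (height b x)
  have hf1 := lt_of_le_of_ne hf (hxb _)
  have hkne : (k : ℝ) ≠ 0 := by linarith
  have hbs : ∀ (z : ℤ) (t : ℝ), k * t = height b x - z →
      toTorus (shift x e.dir t) ∈ b.carrier := by
    intro z t ht
    refine toTorus_shift_mem_carrier.2 ⟨z, ?_⟩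
    rw [dbe]
    push_cast
    linear_combination ht
  -- The crossings with `b` just before and just after `x`; they are `1 / k` apart.
  obtain ⟨s, hs⟩ : ∃ s : ℝ, k * s = height b x - (⌊height b x⌋ + 1 : ℤ) :=
    ⟨(height b x - (⌊height b x⌋ + 1 : ℤ)) / k, mul_div_cancel₀ _ hkne⟩
  obtain ⟨t, ht⟩ : ∃ t : ℝ, k * t = height b x - ⌊height b x⌋ :=
    ⟨(height b x - ⌊height b x⌋) / k, mul_div_cancel₀ _ hkne⟩
  have hsb := hbs _ _ hs
  have htb := hbs _ _ ht
  push_cast at hs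
  have hs0 : s < 0 := by nlinarith
  have ht0 : 0 < t := by nlinarith
  obtain ⟨r, hr1, hr2, hr⟩ := key s 0 hs0 b h.b_mem a h.a_mem (by omega) (by omega) hsb hxa0
  obtain ⟨q, hq1, hq2, hq⟩ := key 0 t ht0 a h.a_mem b h.b_mem (by omega) (by omega) hxa0 htb
  rcases hr with ⟨z, hz⟩ | ⟨z, hz⟩
  · rcases hq with ⟨w, hw⟩ | ⟨w, hw⟩
    -- Two distinct crossings with `c` differ by at least `1 / k`, but both would lie strictly
    -- between `s` and `t`.
    · exfalso
      have h1 : (z : ℝ) < w := by nlinarith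
      have h2 : (w : ℝ) < z + 1 := by nlinarith
      have h1' : z < w := by exact_mod_cast h1
      have h2' : w < z + 1 := by exact_mod_cast h2
      omega
    · exact ⟨q, w, hw, by nlinarith, by nlinarith⟩
  · exact ⟨r, z, hz, by nlinarith, by nlinarith⟩

/-- There is no arrangement dual to the pentagon on which the signs of the crossings alternate
along the lines. -/
theorem not_selectsLeft (h : IsPentagonArrangement k H a b c d e) (hk : 5 ≤ k) (hS : IsSimple H) :
    ¬ SelectsLeft H G := by
  intro hG
  have hdet := h.det_ne_zero hk
  have hkR : (5 : ℝ) ≤ k := by exact_mod_cast hk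
  obtain ⟨δ, z₀, hz₀, hδ1, hδ2⟩ := h.exists_near hk hS hG
  -- The crossing of `a` and `d`, from which positions on `d` are measured.
  obtain ⟨x, hx⟩ : ∃ x : ℝ × ℝ, x = (a.offsetLift, -a.offsetLift - d.offsetLift) := ⟨_, rfl⟩
  have hxd : toTorus x ∈ d.carrier :=
    toTorus_mem_carrier.2 ⟨0, by simp [height, h.d_dir, hx]⟩
  have dad : det a.dir d.dir = -1 := by simp [det, h.a_dir, h.d_dir]
  have dbd : det b.dir d.dir = 1 - k := by simp [det, h.b_dir, h.d_dir]
  have dcd : det c.dir d.dir = k + 1 := by simp [det, h.c_dir, h.d_dir]; ring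
  have ded : det e.dir d.dir = -1 := by simp [det, h.e_dir, h.d_dir]
  have dae : det a.dir e.dir = -1 := by simp [det, h.a_dir, h.e_dir]
  have hxdt : ∀ t, toTorus (shift x d.dir t) ∈ d.carrier := by
    intro t
    rw [toTorus_shift_mem_carrier, det_self]
    simpa [toTorus_mem_carrier] using hxd
  have hdisj : ∀ t, ∀ m ∈ H, ∀ m' ∈ H, det m.dir d.dir ≠ 0 → det m'.dir d.dir ≠ 0 → m ≠ m' →
      toTorus (shift x d.dir t) ∈ m.carrier → toTorus (shift x d.dir t) ∉ m'.carrier := by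
    intro t m hm m' hm' hmd hmd' hmm
    refine hS.notMem_carrier h.d_mem hm hm' ?_ ?_ hmm (hxdt t)
    · rintro rfl
      exact hmd (det_self _)
    · rintro rfl
      exact hmd' (det_self _)
  have hcint : ∀ t, toTorus (shift x d.dir t) ∈ c.carrier ↔
      ∃ z : ℤ, (z : ℝ) = height c x + t * (k + 1) := by
    intro t
    rw [toTorus_shift_mem_carrier, dcd]
    push_cast
    rfl
  have hbint : ∀ t, toTorus (shift x d.dir t) ∈ b.carrier ↔
      ∃ z : ℤ, (z : ℝ) = height b x + t * (1 - k) := by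
    intro t
    rw [toTorus_shift_mem_carrier, dbd]
    push_cast
    rfl
  have key : ∀ s t, s < t → ∀ m ∈ H, ∀ m' ∈ H, det m.dir d.dir < 0 → det m'.dir d.dir < 0 →
      toTorus (shift x d.dir s) ∈ m.carrier → toTorus (shift x d.dir t) ∈ m'.carrier →
      ∃ r, s < r ∧ r < t ∧ ∃ z : ℤ, (z : ℝ) = height c x + r * (k + 1) := by
    intro s t hst m hm m' hm' hmd hmd' hms hmt
    have hme : m ≠ d := by
      rintro rfl
      rw [det_self] at hmd
      omega
    have hme' : m' ≠ d := by
      rintro rfl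
      rw [det_self] at hmd'
      omega
    obtain ⟨r, h1, h2, m'', hm'', hr, hneg⟩ := hG.exists_crossing_between hS hdet h.d_mem hm hm'
      hme hme' hxd hst hms hmt (mul_pos_of_neg_of_neg hmd hmd')
    have hpos : 0 < det m''.dir d.dir := by
      by_contra! hle
      nlinarith
    refine ⟨r, h1, h2, ?_⟩
    rcases h.eq_or m'' hm'' with rfl | rfl | rfl | rfl | rfl
    · omega
    · omega
    · exact (hcint r).1 hr
    · rw [det_self] at hpos
      omega
    · omega
  -- an interval between adjacent crossings with `c` that meets `a` or `e` does not meet `b`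
  have noB : ∀ (w : ℤ) (p : ℝ) (m : OrientedLine), m ∈ H → det m.dir d.dir < 0 → m ≠ b →
      toTorus (shift x d.dir p) ∈ m.carrier →
      (w : ℝ) ≤ height c x + p * (k + 1) → height c x + p * (k + 1) ≤ w + 1 →
      ∀ q : ℝ, (w : ℝ) ≤ height c x + q * (k + 1) → height c x + q * (k + 1) ≤ w + 1 →
      toTorus (shift x d.dir q) ∉ b.carrier := by
    intro w p m hm hmd hmb hp hp1 hp2 q hq1 hq2 hqb
    have hcb : c ≠ b := by
      rintro rfl
      omega
    have hqc : ∀ z : ℤ, (z : ℝ) ≠ height c x + q * (k + 1) := by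
      intro z hz
      exact hdisj q c h.c_mem b h.b_mem (by omega) (by omega) hcb ((hcint q).2 ⟨z, hz⟩) hqb
    have hpc : ∀ z : ℤ, (z : ℝ) ≠ height c x + p * (k + 1) := by
      intro z hz
      refine hdisj p c h.c_mem m hm (by omega) (by omega) ?_ ((hcint p).2 ⟨z, hz⟩) hp
      rintro rfl
      omega
    have hbd : det b.dir d.dir < 0 := by omega
    have hq1' := lt_of_le_of_ne hq1 (hqc w)
    have hq2' := lt_of_le_of_ne hq2 fun he => hqc (w + 1) (by rw [he]; push_cast; rfl)
    have hp1' := lt_of_le_of_ne hp1 (hpc w)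
    have hp2' := lt_of_le_of_ne hp2 fun he => hpc (w + 1) (by rw [he]; push_cast; rfl)
    -- Two negative crossings in one gap would force a crossing with `c` strictly inside it.
    rcases lt_trichotomy p q with hpq | hpq | hpq
    · obtain ⟨r, hr1, hr2, z, hz⟩ := key p q hpq m hm b h.b_mem hmd hbd hp hqb
      exact not_int_of_between (a := height c x + r * (k + 1)) (z := w) (w := z)
        ⟨by nlinarith, by nlinarith⟩ hz
    · subst hpq
      exact hdisj p m hm b h.b_mem (by omega) (by omega) hmb hp hqb
    · obtain ⟨r, hr1, hr2, z, hz⟩ := key q p hpq b h.b_mem m hm hbd hmd hqb hp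
      exact not_int_of_between (a := height c x + r * (k + 1)) (z := w) (w := z)
        ⟨by nlinarith, by nlinarith⟩ hz
  -- the two near crossings
  have hda : toTorus (shift x d.dir 0) ∈ a.carrier := by
    rw [toTorus_shift_mem_carrier]
    exact ⟨0, by simp [height, h.a_dir, hx]⟩
  -- Since `d.dir = e.dir - a.dir`, the sides along `d` and `e` of the triangle cut out by `a`, `d`,
  -- `e` have the same parameter length, so the `δ` found on `e` also serves on `d`.
  have hde : toTorus (shift x d.dir δ) ∈ e.carrier := by
    rw [toTorus_shift_mem_carrier, ded]
    refine ⟨-z₀, ?_⟩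
    simp only [height, h.e_dir, hx]
    push_cast
    linear_combination -hz₀
  have hae : a ≠ e := by
    rintro rfl
    rw [det_self] at dae
    omega
  have hab : a ≠ b := by
    rintro rfl
    omega
  have heb : e ≠ b := by
    rintro rfl
    omega
  have hδ0 : δ ≠ 0 := by
    rintro rfl
    exact hdisj 0 a h.a_mem e h.e_mem (by omega) (by omega) hae hda hde
  -- existence of crossings with `b`
  have exB : ∀ s : ℝ, ∃ t, s ≤ t ∧ (k - 1) * t ≤ (k - 1) * s + 1 ∧
      toTorus (shift x d.dir t) ∈ b.carrier := by
    intro s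
    have hf := Int.floor_le (height b x + s * (1 - k))
    have hf' := Int.lt_floor_add_one (height b x + s * (1 - k))
    have hk1 : (k : ℝ) - 1 ≠ 0 := by linarith
    obtain ⟨t, ht⟩ : ∃ t : ℝ, (k - 1) * t = height b x - ⌊height b x + s * (1 - k)⌋ :=
      ⟨(height b x - ⌊height b x + s * (1 - k)⌋) / (k - 1), mul_div_cancel₀ _ hk1⟩
    refine ⟨t, by nlinarith, by nlinarith, (hbint t).2 ⟨⌊height b x + s * (1 - k)⌋, ?_⟩⟩
    linear_combination ht
  -- Positions on `d` are compared through the height of `c`, whose integral values bound the gaps.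
  -- The point `u` lies in gap `w`; a crossing with `c` separates `v` from `u`, and `v - u < 1 / k`,
  -- so `v` lies in gap `w + 1` or `w + 2`.
  have main : ∀ u v : ℝ, ∀ m ∈ H, ∀ m' ∈ H, u < v → k * (v - u) < 1 → det m.dir d.dir < 0 →
      det m'.dir d.dir < 0 → m ≠ b → m' ≠ b → toTorus (shift x d.dir u) ∈ m.carrier →
      toTorus (shift x d.dir v) ∈ m'.carrier → False := by
    intro u v m hm m' hm' huv hk' hmd hmd' hmb hmb' hu hv
    obtain ⟨r, hr1, hr2, z, hz⟩ := key u v huv m hm m' hm' hmd hmd' hu hv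
    obtain ⟨w, hw⟩ : ∃ w : ℤ, w = ⌊height c x + u * (k + 1)⌋ := ⟨_, rfl⟩
    have hf : (w : ℝ) ≤ height c x + u * (k + 1) := by
      rw [hw]
      exact Int.floor_le _
    have hf' : height c x + u * (k + 1) < w + 1 := by
      rw [hw]
      exact Int.lt_floor_add_one _
    have hwz : (w : ℝ) + 1 ≤ z := by
      have h1 : (w : ℝ) < z := by nlinarith
      have h1' : w < z := by exact_mod_cast h1
      exact_mod_cast h1'
    have hv1 : (w : ℝ) + 1 ≤ height c x + v * (k + 1) := by nlinarith
    have hv2 : height c x + v * (k + 1) ≤ w + 3 := by nlinarith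
    have B0 := noB w u m hm hmd hmb hu hf hf'.le
    obtain ⟨s, hs⟩ : ∃ s : ℝ, height c x + s * (k + 1) = w :=
      ⟨(w - height c x) / (k + 1), by rw [div_mul_cancel₀ _ (by linarith)]; ring⟩
    obtain ⟨t, ht1, ht2, ht⟩ := exB s
    have T1 : (w : ℝ) ≤ height c x + t * (k + 1) := by nlinarith
    -- Measured in gaps, the crossings with `b` have spacing `(k + 1) / (k - 1) ≤ 2`, so one of them
    -- falls into gap `w` or `w + 1`.
    have T2 : height c x + t * (k + 1) ≤ w + 2 := by nlinarith
    rcases le_total (height c x + v * (k + 1)) (w + 2) with hv3 | hv3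
    · have B1 := noB (w + 1) v m' hm' hmd' hmb' hv (by push_cast; linarith)
        (by push_cast; linarith)
      rcases le_total (height c x + t * (k + 1)) (w + 1) with h1 | h1
      · exact B0 t T1 h1 ht
      · exact B1 t (by push_cast; linarith) (by push_cast; linarith) ht
    · have B1 := noB (w + 2) v m' hm' hmd' hmb' hv (by push_cast; linarith)
        (by push_cast; linarith)
      have T3 : (w : ℝ) + 1 < height c x + t * (k + 1) := by
        by_contra! h1
        exact B0 t T1 h1 ht
      have hk1 : (k : ℝ) - 1 ≠ 0 := by linarith
      obtain ⟨q, hq⟩ : ∃ q : ℝ, (k - 1) * q = 1 := ⟨1 / (k - 1), mul_div_cancel₀ _ hk1⟩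
      have hq1 : 1 < q * (k + 1) := by nlinarith
      -- This bound on the spacing `q` is equivalent to `k ≥ 5`. The crossing `t` lies beyond `w +
      -- 1` and at most one spacing after `w`, so the next one, `t + q`, is beyond `w + 2` and at
      -- most at `w + 3`: it falls into the gap of `v`.
      have hq2 : 2 * (q * (k + 1)) ≤ 3 := by nlinarith
      have hts : t ≤ s + q := by nlinarith
      refine B1 (t + q) ?_ ?_ ?_
      · push_cast
        linarith
      · push_cast
        nlinarith
      · obtain ⟨y, hy⟩ := (hbint t).1 ht
        refine (hbint (t + q)).2 ⟨y - 1, ?_⟩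
        push_cast
        linear_combination hy + hq
  rcases hδ0.lt_or_gt with hδ | hδ
  · exact main δ 0 e h.e_mem a h.a_mem hδ (by linarith) (by omega) (by omega) heb hab hde hda
  · exact main 0 δ a h.a_mem e h.e_mem hδ (by linarith) (by omega) (by omega) hab heb hda hde

end IsPentagonArrangement

end ToricDimer

/-! ### Consequences for admissibility and for the two algorithms -/

theorem mainTheorem6 (k : ℤ) (hk : 5 ≤ k) :
    (∀ H : ToricDimer.Arrangement,
        ToricDimer.IsDual H (ToricDimer.pentagon k (by omega)) → ToricDimer.IsSimple H →
          ¬ ToricDimer.IsAdmissible H) ∧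
    (¬ ∃ G, ToricDimer.HananyVeghOutput (ToricDimer.pentagon k (by omega)) G ∧ G.IsBipartite) ∧
    (¬ ∃ G, ToricDimer.StienstraGraph (ToricDimer.pentagon k (by omega)) G ∧ G.IsBipartite) := by
  have not_admissible : ∀ H : ToricDimer.Arrangement,
      ToricDimer.IsDual H (ToricDimer.pentagon k (by omega)) → ToricDimer.IsSimple H →
        ¬ ToricDimer.IsAdmissible H := by
    intro H hD hS hA
    obtain ⟨a, b, c, d, e, h⟩ := hD.exists_isPentagonArrangement
    exact h.not_selectsLeft hk hS hA.selectsLeft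
  refine ⟨not_admissible, ?_, ?_⟩
  · rintro ⟨_, ⟨H, hD, hS, hA, -⟩, -⟩
    exact not_admissible H hD hS hA
  · rintro ⟨_, ⟨H, ι, hD, hS, hι, rfl⟩, hG⟩
    obtain ⟨a, b, c, d, e, h⟩ := hD.exists_isPentagonArrangement
    exact h.not_selectsLeft hk hS (hι.selectsLeft hG)
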